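/- Let $d\in\mathbb N$ and write $\hat f(\xi)=\int_{\mathbb R^d}f(x)e^{-2\pi i x\cdot\xi}\,dx$ for the Fourier transform, extended to $L^2(\mathbb R^d)$ by Plancherel; the support $\operatorname{supp} g$ of $g\in L^2(\mathbb R^d)$ is the set of points all of whose neighbourhoods meet $\{g\ne 0\}$ in positive measure. Let $\{\psi_\lambda\}_{\lambda\in\Lambda}\subset L^2(\mathbb R^d)$ be real-valued and band-limited, i.e. $F_\lambda:=\operatorname{supp}\hat\psi_\lambda$ is compact for every $\lambda$, and suppose that they generate a semi-discrete frame: there are constants $B\ge A>0$ with $$A\|g\|_2^2\le\sum_{\lambda\in\Lambda}\|g*\psi_\lambda\|_2^2\le B\|g\|_2^2\qquad\text{for all } g\in L^2(\mathbb R^d).$$ Suppose that the frame has good Fourier-support overlap: there are non-empty open sets $U_\lambda\subseteq F_\lambda$ ($\lambda\in\Lambda$) with $\bigcup_{\lambda}U_\lambda=\mathbb R^d$ such that, whenever $U_\lambda\cap U_\mu\neq\emptyset$, the product $\hat\psi_\lambda\hat\psi_\mu$ does not vanish almost everywhere on $U_\lambda\cap U_\mu$ (this last condition is automatic if the $\hat\psi_\lambda$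 are continuous). For each $\lambda$ let $X_\lambda$ be a sign-blind sampling set for $F_\lambda$, i.e. a lattice $X_\lambda=(M_\lambda^{\top})^{-1}\operatorname{diag}(2s_{\lambda,1},\dots,2s_{\lambda,d})^{-1}\mathbb Z^d$, where $M_\lambda$ is a non-singular real $d\times d$ matrix with $F_\lambda\subseteq M_\lambda[-\tfrac12,\tfrac12]^d$ and $s_{\lambda,1},\dots,s_{\lambda,d}\ge 1$. Let $f\in L^2(\mathbb R^d)$ be real-valued with $\int_{\mathbb R^d}|f(x)|e^{\alpha|x|}\,dx<\infty$ for some $\alpha>0$. If a real-valued $h\in L^2(\mathbb R^d)$ satisfies $|(h*\psi_\lambda)(x)|=|(f*\psi_\lambda)(x)|$ for every $\lambda\in\Lambda$ and every $x\in X_\lambda$, then $h=f$ or $h=-f$ (almost everywhere). -/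

import Mathlib

open MeasureTheory FourierTransform
open scoped ENNReal Topology Matrix

namespace SignRetrieval

noncomputable section

/-- `ℝ^d` with the Euclidean norm. -/
abbrev Rd (d : ℕ) : Type := EuclideanSpace ℝ (Fin d)

/-- `L²(ℝ^d, ℝ)`. -/
abbrev L2R (d : ℕ) : Type := Lp ℝ 2 (volume : Measure (Rd d))

/-- `L²(ℝ^d)`, complex-valued. -/
abbrev L2C (d : ℕ) : Type := Lp ℂ 2 (volume : Measure (Rd d))

/-- The inclusion of `L²(ℝ^d, ℝ)` in `L²(ℝ^d)`. -/
def toComplex {d : ℕ} (f : L2R d) : L2C d := Complex.ofRealCLM.compLp f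

/-- The convolution `(f ∗ g)(x) = ∫ f(t) g(x - t) dt`. For `f, g ∈ L²` the integral converges
absolutely for every `x` and does not depend on the representatives. -/
def conv {d : ℕ} {𝕜 : Type} [RCLike 𝕜] (f g : Lp 𝕜 2 (volume : Measure (Rd d))) : Rd d → 𝕜 :=
  convolution (f : Rd d → 𝕜) (g : Rd d → 𝕜) (ContinuousLinearMap.mul ℝ 𝕜) volume

/-- The `L²` (Plancherel) Fourier transform of a real-valued function, with the normalization
`∫ f(x) exp(-2πi x·ξ) dx`. -/
def fourierL2 {d : ℕ} (f : L2R d) : L2C d := 𝓕 (toComplex f)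

/-- The (closed, essential) support of a function defined up to null sets: the points all of
whose neighbourhoods meet `{g ≠ 0}` in positive measure. -/
def essSupport {d : ℕ} (g : Rd d → ℂ) : Set (Rd d) :=
  {ξ | ∀ V ∈ 𝓝 ξ, volume (V ∩ Function.support g) ≠ 0}

/-- `F_λ = supp ψ̂_λ`. -/
def freqSupport {d : ℕ} (ψ : L2R d) : Set (Rd d) := essSupport (fourierL2 ψ : Rd d → ℂ)

/-- `ψ` is band-limited. -/
def IsBandLimited {d : ℕ} (ψ : L2R d) : Prop := IsCompact (freqSupport ψ)

/-- The translates of the `ψ_λ` form a semi-discrete frame: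
`A ‖f‖₂² ≤ ∑_λ ‖f ∗ ψ_λ‖₂² ≤ B ‖f‖₂²` for all `f ∈ L²(ℝ^d)`, with `B ≥ A > 0`. -/
def IsSemiDiscreteFrame {d : ℕ} {Λ : Type*} (ψ : Λ → L2R d) : Prop :=
  ∃ A B : ℝ, 0 < A ∧ A ≤ B ∧ ∀ f : L2C d,
    ENNReal.ofReal A * eLpNorm f 2 volume ^ 2
        ≤ ∑' l, eLpNorm (conv f (toComplex (ψ l))) 2 volume ^ 2 ∧
      ∑' l, eLpNorm (conv f (toComplex (ψ l))) 2 volume ^ 2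
        ≤ ENNReal.ofReal B * eLpNorm f 2 volume ^ 2

/-- Good Fourier-support overlap: nonempty open `U_λ ⊆ supp ψ̂_λ` cover `ℝ^d`, and where `U_λ` and
`U_μ` meet, `ψ̂_λ` and `ψ̂_μ` are simultaneously nonzero on a part of `U_λ ∩ U_μ` of positive
measure. The last clause follows from the others if the `ψ̂_λ` have continuous representatives;
for arbitrary `ψ_λ ∈ L²` it does not, since the functions `ψ̂_λ`, `ψ̂_μ` may be nonzero exactly on disjoint
sets that are both of positive measure in every ball. -/
def HasGoodFSupportOverlap {d : ℕ} {Λ : Type*} (ψ : Λ → L2R d) : Prop :=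
  ∃ U : Λ → Set (Rd d),
    (∀ l, IsOpen (U l) ∧ (U l).Nonempty ∧ U l ⊆ freqSupport (ψ l)) ∧
    (⋃ l, U l) = Set.univ ∧
    ∀ l m, (U l ∩ U m).Nonempty →
      volume {ξ | ξ ∈ U l ∩ U m ∧ fourierL2 (ψ l) ξ ≠ 0 ∧ fourierL2 (ψ m) ξ ≠ 0} ≠ 0

/-- `M [-1/2, 1/2]^d`. -/
def imageCube {d : ℕ} (M : Matrix (Fin d) (Fin d) ℝ) : Set (Rd d) :=
  {y | ∃ t : Fin d → ℝ, (∀ i, t i ∈ Set.Icc (-(1 / 2) : ℝ) (1 / 2)) ∧ y = WithLp.toLp 2 (M *ᵥ t)}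

/-- The lattice `(Mᵀ)⁻¹ D[2s]⁻¹ ℤ^d`. -/
def samplingLattice {d : ℕ} (M : Matrix (Fin d) (Fin d) ℝ) (s : Fin d → ℝ) : Set (Rd d) :=
  Set.range fun n : Fin d → ℤ =>
    (WithLp.toLp 2 ((Mᵀ)⁻¹ *ᵥ ((Matrix.diagonal fun i => 2 * s i)⁻¹ *ᵥ fun i => (n i : ℝ))) : Rd d)

/-- `X` is a sign-blind sampling set for the compact set `F`. -/
def IsSignBlindSamplingSet {d : ℕ} (F X : Set (Rd d)) : Prop :=
  IsCompact F ∧ ∃ (M : Matrix (Fin d) (Fin d) ℝ) (s : Fin d → ℝ),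
    IsUnit M.det ∧ F ⊆ imageCube M ∧ (∀ i, 1 ≤ s i) ∧ X = samplingLattice M s

end

end SignRetrieval

/-! For one filter put `u = f ∗ ψ` and `v = h ∗ ψ`. By the `L²` convolution theorem
`conv_eq_fourierInv` these are inverse Fourier integrals of the integrable functions `G = f̂ψ̂` and
`H = ĥψ̂`, which live on the compact set `F ⊆ M[-1/2,1/2]^d`. Equal moduli of real samples mean that
`u² - v²` vanishes on the lattice. This function has its spectrum in `F + F`, inside the doubled
parallelepiped, and the factors `2 s_i` with `s_i ≥ 1` make the lattice dense enough to determine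
it, so `u² = v²` everywhere (`sq_fourierInv_eq_of_lattice`). The critical density `s_i = 1` is
allowed because `G` and `H` are functions, so the boundary of the parallelepiped carries no mass.
Both `u - v` and `u + v` are analytic along lines and their product is zero, hence one of them
vanishes: `u = ± v` (`conv_eq_or_eq_neg`).

It remains to match the signs. If `f ≠ 0`, exponential decay makes `f̂` analytic along lines, hence
nonzero almost everywhere (`fourierL2_ae_ne_zero`). Opposite signs on two overlapping filters would
give `f̂ = ĥ = -f̂` on a set of positive measure. So the sets `U_λ` with sign plus and those with
sign minus have disjoint unions, and connectedness of `ℝ^d` leaves a single sign. The lower frame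
bound, applied to `f - h` or `f + h`, then gives the conclusion. -/

namespace SignRetrieval

/-! ### Functions analytic along lines, and their zero sets -/

section LineAnalytic

variable {E : Type*} [NormedAddCommGroup E] [InnerProductSpace ℝ E]

/-- A two-sided exponential integral is holomorphic on the strip where it converges. -/
theorem differentiableOn_integral_mul_cexp {Ω : Type*} [MeasurableSpace Ω] {μ : Measure Ω}
    {Γ : Ω → ℂ} {p : Ω → ℝ} {c : ℝ} (hΓ : AEStronglyMeasurable Γ μ) (hp : AEMeasurable p μ)
    (hint : Integrable (fun ω => ‖Γ ω‖ * Real.exp (c * |p ω|)) μ) :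
    DifferentiableOn ℂ (fun z : ℂ => ∫ ω, Γ ω * Complex.exp (z * p ω) ∂μ) {z | |z.re| < c} := by
  intro z hz
  simp only [Set.mem_ofPred_eq] at hz
  -- One `ε` pays for moving `z` within a ball, the other absorbs the factor `p ω` produced by
  -- differentiation.
  obtain ⟨ε, hε, hεc⟩ : ∃ ε > 0, |z.re| + 2 * ε < c :=
    ⟨(c - |z.re|) / 4, by linarith, by linarith⟩
  have hpc : AEStronglyMeasurable (fun ω => (p ω : ℂ)) μ :=
    (Complex.measurable_ofReal.comp_aemeasurable hp).aestronglyMeasurable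
  have hmeas : ∀ w : ℂ, AEStronglyMeasurable (fun ω => Γ ω * Complex.exp (w * p ω)) μ := fun w =>
    hΓ.mul (Complex.continuous_exp.comp_aestronglyMeasurable (hpc.const_mul w))
  have hnorm : ∀ (w : ℂ) ω, ‖Complex.exp (w * p ω)‖ ≤ Real.exp (|w.re| * |p ω|) := by
    intro w ω
    rw [Complex.norm_exp]
    apply Real.exp_le_exp.2
    simp only [Complex.mul_re, Complex.ofReal_re, Complex.ofReal_im, mul_zero, sub_zero]
    rw [← abs_mul]
    exact le_abs_self _
  have key := hasDerivAt_integral_of_dominated_loc_of_deriv_le (𝕜 := ℂ) (μ := μ)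
    (F := fun (w : ℂ) ω => Γ ω * Complex.exp (w * p ω))
    (F' := fun (w : ℂ) ω => Γ ω * (Complex.exp (w * p ω) * p ω))
    (bound := fun ω => ε⁻¹ * (‖Γ ω‖ * Real.exp (c * |p ω|)))
    (x₀ := z) (Metric.ball_mem_nhds z hε) (Filter.Eventually.of_forall hmeas)
    (hint.mono' (hmeas z) (Filter.Eventually.of_forall fun ω => by
      rw [norm_mul]
      gcongr
      exact (hnorm z ω).trans (Real.exp_le_exp.2 (by gcongr)))) ?_ ?_ (hint.const_mul _) ?_
  · exact key.2.differentiableAt.differentiableWithinAt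
  · simpa only [mul_assoc, Pi.mul_def] using (hmeas z).mul hpc
  · refine Filter.Eventually.of_forall fun ω w hw => ?_
    have hwre : |w.re| ≤ |z.re| + ε := by
      have h1 : |w.re - z.re| ≤ ‖w - z‖ := by simpa using Complex.abs_re_le_norm (w - z)
      have h2 : ‖w - z‖ < ε := by simpa [dist_eq_norm] using hw
      have h3 := abs_sub_abs_le_abs_sub w.re z.re
      linarith
    have h4 : ε * |p ω| ≤ Real.exp (ε * |p ω|) := by
      linarith [Real.add_one_le_exp (ε * |p ω|)]
    have h5 : |p ω| ≤ ε⁻¹ * Real.exp (ε * |p ω|) := by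
      rw [inv_mul_eq_div, le_div_iff₀ hε]; linarith
    rw [norm_mul, norm_mul]
    calc ‖Γ ω‖ * (‖Complex.exp (w * p ω)‖ * ‖(p ω : ℂ)‖)
        ≤ ‖Γ ω‖ * (Real.exp ((|z.re| + ε) * |p ω|) * (ε⁻¹ * Real.exp (ε * |p ω|))) := by
          gcongr
          · exact (hnorm w ω).trans (Real.exp_le_exp.2 (by gcongr))
          · simpa using h5
      _ = ε⁻¹ * (‖Γ ω‖ * Real.exp ((|z.re| + 2 * ε) * |p ω|)) := by
          rw [show (|z.re| + 2 * ε) * |p ω| = (|z.re| + ε) * |p ω| + ε * |p ω| by ring,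
            Real.exp_add]
          ring
      _ ≤ _ := by gcongr
  · refine Filter.Eventually.of_forall fun ω w _ => ?_
    refine HasDerivAt.const_mul _ ?_
    have := (hasDerivAt_mul_const (x := w) (p ω : ℂ)).cexp
    simpa using this

/-- The restriction of an exponential integral to the imaginary axis is real analytic. -/
theorem analyticOnNhd_integral_mul_cexp {Ω : Type*} [MeasurableSpace Ω] {μ : Measure Ω}
    {Γ : Ω → ℂ} {p : Ω → ℝ} {c : ℝ} (hc : 0 < c) (hΓ : AEStronglyMeasurable Γ μ)
    (hp : AEMeasurable p μ) (hint : Integrable (fun ω => ‖Γ ω‖ * Real.exp (c * |p ω|)) μ) :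
    AnalyticOnNhd ℝ (fun t : ℝ => ∫ ω, Γ ω * Complex.exp (Complex.I * t * p ω) ∂μ) Set.univ := by
  have hopen : IsOpen {z : ℂ | |z.re| < c} :=
    isOpen_lt (by fun_prop) continuous_const
  have h := (differentiableOn_integral_mul_cexp hΓ hp hint).analyticOnNhd hopen
  intro t _
  have hI : AnalyticAt ℝ (fun t : ℝ => Complex.I * t) t :=
    analyticAt_const.mul (Complex.ofRealCLM.analyticAt t)
  have hΦ := (h (Complex.I * t) (by simpa using hc)).restrictScalars (𝕜 := ℝ)
  exact AnalyticAt.fun_comp (f := fun t : ℝ => Complex.I * t) hΦ hI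

/-- `a` is real analytic along every line. -/
def LineAnalytic (a : E → ℂ) : Prop :=
  ∀ x v : E, AnalyticOnNhd ℝ (fun t : ℝ => a (x + t • v)) Set.univ

theorem LineAnalytic.comp_neg {a : E → ℂ} (ha : LineAnalytic a) :
    LineAnalytic fun x => a (-x) := by
  intro x v
  have := ha (-x) (-v)
  simpa only [smul_neg, ← neg_add] using this

theorem LineAnalytic.add {a b : E → ℂ} (ha : LineAnalytic a) (hb : LineAnalytic b) :
    LineAnalytic (a + b) := fun x v => (ha x v).add (hb x v)

theorem LineAnalytic.sub {a b : E → ℂ} (ha : LineAnalytic a) (hb : LineAnalytic b) :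
    LineAnalytic (a - b) := fun x v => (ha x v).sub (hb x v)

/-- The one-variable identity theorem suffices: on the line from a point where `a ≠ 0` to a point
where `b ≠ 0`, `b` vanishes near the first point, hence along the whole line. -/
theorem LineAnalytic.eq_zero_or_eq_zero_of_mul_eq_zero {a b : E → ℂ} (ha : LineAnalytic a)
    (hb : LineAnalytic b) (hab : ∀ x, a x * b x = 0) : (∀ x, a x = 0) ∨ ∀ x, b x = 0 := by
  by_contra! hcon
  obtain ⟨⟨x, hx⟩, y, hy⟩ := hcon
  have h1 : ∀ᶠ t : ℝ in 𝓝 0, a (x + t • (y - x)) ≠ 0 := by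
    have := ((ha x (y - x)) 0 (Set.mem_univ _)).continuousAt
    exact this.eventually_ne (by simpa using hx)
  have h2 : (fun t : ℝ => b (x + t • (y - x))) =ᶠ[𝓝 0] 0 := by
    filter_upwards [h1] with t ht
    exact (mul_eq_zero.1 (hab _)).resolve_left ht
  have h3 := (hb x (y - x)).eqOn_zero_of_preconnected_of_eventuallyEq_zero
    isPreconnected_univ (Set.mem_univ 0) h2
  exact hy (by simpa using h3 (Set.mem_univ 1))

/-- A measurable set that meets almost no point of every line through the origin is null. -/
theorem measure_eq_zero_of_forall_line [FiniteDimensional ℝ E] [MeasurableSpace E] [BorelSpace E]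
    (μ : Measure E) [μ.IsAddHaarMeasure] {Z : Set E} (hZ : MeasurableSet Z)
    (h : ∀ x, volume {t : ℝ | t • x ∈ Z} = 0) : μ Z = 0 := by
  have hS : MeasurableSet {q : ℝ × E | q.1 • q.2 ∈ Z} :=
    (measurable_fst.smul measurable_snd) hZ
  have h1 : (volume.prod μ) {q : ℝ × E | q.1 • q.2 ∈ Z} = 0 := by
    rw [Measure.prod_apply_symm hS]
    exact lintegral_eq_zero_of_ae_eq_zero (Filter.Eventually.of_forall h)
  have h2 := (Measure.measure_prod_null hS).1 h1
  have h3 : ∀ᵐ t : ℝ, t ≠ 0 := by simp [ae_iff]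
  -- By Fubini almost every dilate of `Z` is null; a single nonzero `t` is enough, since dilations
  -- scale Haar measure.
  obtain ⟨t, ht, ht0⟩ := (h2.and h3).exists
  have h4 : Prod.mk t ⁻¹' {q : ℝ × E | q.1 • q.2 ∈ Z} = (fun x => t • x) ⁻¹' Z := rfl
  simp only [Pi.zero_apply] at ht
  rw [h4, Measure.addHaar_preimage_smul μ ht0] at ht
  refine (mul_eq_zero.1 ht).resolve_left ?_
  simp [ht0]

/-- After translating a point with `a x ≠ 0` to the origin, `a` is not identically zero on any line
through it, so its zeros on each such line are discrete. -/
theorem LineAnalytic.measure_zeros_eq_zero [FiniteDimensional ℝ E] [MeasurableSpace E]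
    [BorelSpace E] (μ : Measure E) [μ.IsAddHaarMeasure] {a : E → ℂ} (ha : LineAnalytic a)
    (hm : Measurable a) {x : E} (hx : a x ≠ 0) : μ {y | a y = 0} = 0 := by
  have h1 : μ ((fun y => x + y) ⁻¹' {y | a y = 0}) = 0 := by
    refine measure_eq_zero_of_forall_line μ ?_ fun v => ?_
    · exact (measurable_const_add x) (hm (measurableSet_singleton 0))
    · have h2 := (ha x v).preimage_zero_mem_codiscrete (x := 0) (by simpa using hx)
      have h3 := ae_restrict_le_codiscreteWithin (μ := (volume : Measure ℝ)) MeasurableSet.univ h2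
      rw [Measure.restrict_univ, mem_ae_iff] at h3
      refine measure_mono_null ?_ h3
      intro t ht
      simpa using ht
  rwa [measure_preimage_add] at h1

theorem lineAnalytic_fourier [MeasurableSpace E] [BorelSpace E] [FiniteDimensional ℝ E]
    {Γ : E → ℂ} {c : ℝ} (hc : 0 < c)
    (hΓ : AEStronglyMeasurable Γ) (hint : Integrable (fun ξ => ‖Γ ξ‖ * Real.exp (c * ‖ξ‖))) :
    LineAnalytic (𝓕 Γ) := by
  intro x v
  -- Chosen so that `c' * 2π|⟪ξ, v⟫| ≤ c * ‖ξ‖`; the `+ 1` covers `v = 0`.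
  set c' := c / (2 * Real.pi * ‖v‖ + 1) with hc'
  have hpos : 0 < 2 * Real.pi * ‖v‖ + 1 := by positivity
  have hc'pos : 0 < c' := div_pos hc hpos
  have hch : Measurable fun ξ : E => Complex.exp (((-(2 * Real.pi * inner ℝ ξ x) : ℝ) : ℂ)
      * Complex.I) := by fun_prop
  have hch1 : ∀ ξ : E, ‖Complex.exp (((-(2 * Real.pi * inner ℝ ξ x) : ℝ) : ℂ)
      * Complex.I)‖ = 1 := fun ξ => Complex.norm_exp_ofReal_mul_I _
  have hp : Measurable fun ξ : E => -(2 * Real.pi * inner ℝ ξ v) := by fun_prop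
  have key := analyticOnNhd_integral_mul_cexp (μ := (volume : Measure E))
    (Γ := fun ξ => Complex.exp (((-(2 * Real.pi * inner ℝ ξ x) : ℝ) : ℂ) * Complex.I) * Γ ξ)
    (p := fun ξ => -(2 * Real.pi * inner ℝ ξ v)) hc'pos
    (hch.aestronglyMeasurable.mul hΓ) hp.aemeasurable ?_
  · convert key using 2 with t
    rw [Real.fourier_eq']
    congr 1
    ext ξ
    rw [smul_eq_mul, mul_right_comm (Complex.exp _) (Γ ξ), ← Complex.exp_add, inner_add_right,
      inner_smul_right]
    congr 2
    push_cast
    ring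
  · refine hint.mono' ?_ (Filter.Eventually.of_forall fun ξ => ?_)
    · exact (hch.aestronglyMeasurable.mul hΓ).norm.mul
        (by fun_prop : Measurable fun ξ : E =>
          Real.exp (c' * |-(2 * Real.pi * inner ℝ ξ v)|)).aestronglyMeasurable
    · rw [norm_mul, norm_norm, norm_mul, hch1, one_mul, Real.norm_of_nonneg (Real.exp_nonneg _)]
      gcongr ?_ * Real.exp ?_
      rw [abs_neg, abs_mul, abs_of_pos (by positivity : 0 < 2 * Real.pi)]
      have h1 : |inner ℝ ξ v| ≤ ‖ξ‖ * ‖v‖ := abs_real_inner_le_norm ξ v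
      calc c' * (2 * Real.pi * |inner ℝ ξ v|) ≤ c' * (2 * Real.pi * (‖ξ‖ * ‖v‖)) := by gcongr
        _ = c * ‖ξ‖ * (2 * Real.pi * ‖v‖ / (2 * Real.pi * ‖v‖ + 1)) := by
          rw [hc']; field_simp
        _ ≤ c * ‖ξ‖ * 1 := by
          gcongr
          rw [div_le_one hpos]; linarith
        _ = c * ‖ξ‖ := mul_one _

end LineAnalytic

/-! ### The Plancherel transform and the convolution theorem -/

section FourierL2

open scoped SchwartzMap

variable {d : ℕ}

theorem integrable_mul_of_L2 (f g : L2C d) : Integrable fun ξ => f ξ * g ξ :=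
  (Lp.memLp f).integrable_mul (Lp.memLp g)

theorem norm_integral_mul_mul_le (c : Rd d → ℂ) (hc : ∀ ξ, ‖c ξ‖ ≤ 1) (f g : L2C d) :
    ‖∫ ξ, c ξ * (f ξ * g ξ)‖ ≤ ‖f‖ * ‖g‖ := by
  have hfg : Integrable fun ξ => ‖f ξ‖ * ‖g ξ‖ := by
    simpa only [norm_mul] using (integrable_mul_of_L2 f g).norm
  have h1 : ‖∫ ξ, c ξ * (f ξ * g ξ)‖ ≤ ∫ ξ, ‖f ξ‖ * ‖g ξ‖ := by
    refine norm_integral_le_of_norm_le hfg (Filter.Eventually.of_forall fun ξ => ?_)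
    rw [norm_mul, norm_mul]
    exact mul_le_of_le_one_left (by positivity) (hc ξ)
  refine h1.trans ?_
  have h2 := integral_mul_norm_le_Lp_mul_Lq (μ := (volume : Measure (Rd d))) (f := f) (g := g)
    Real.HolderConjugate.two_two (by simpa using Lp.memLp f) (by simpa using Lp.memLp g)
  refine h2.trans (le_of_eq ?_)
  have h3 : ∀ u : L2C d, (∫ ξ, ‖u ξ‖ ^ (2 : ℝ)) ^ (1 / (2 : ℝ)) = ‖u‖ := by
    intro u
    rw [Lp.norm_def, (Lp.memLp u).eLpNorm_eq_integral_rpow_norm (by simp) (by simp),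
      ENNReal.toReal_ofReal (by positivity)]
    simp
  rw [h3, h3]

/-- The bilinear form `(f, g) ↦ ∫ c f g` on `L²`, for a measurable `c` bounded by `1`. -/
noncomputable def weightedPairing (c : Rd d → ℂ) (hcm : Measurable c) (hc : ∀ ξ, ‖c ξ‖ ≤ 1) :
    L2C d →L[ℂ] L2C d →L[ℂ] ℂ :=
  have hint : ∀ f g : L2C d, Integrable fun ξ => c ξ * (f ξ * g ξ) := fun f g =>
    (integrable_mul_of_L2 f g).bdd_mul hcm.aestronglyMeasurable
      (Filter.Eventually.of_forall hc)
  LinearMap.mkContinuous₂ (LinearMap.mk₂ ℂ (fun f g => ∫ ξ, c ξ * (f ξ * g ξ))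
    (fun f f' g => by
      rw [← integral_add (hint f g) (hint f' g)]
      refine integral_congr_ae ?_
      filter_upwards [Lp.coeFn_add f f'] with ξ h
      rw [h, Pi.add_apply]; ring)
    (fun a f g => by
      rw [← integral_smul]
      refine integral_congr_ae ?_
      filter_upwards [Lp.coeFn_smul a f] with ξ h
      rw [h, Pi.smul_apply, smul_eq_mul, smul_eq_mul]; ring)
    (fun f g g' => by
      rw [← integral_add (hint f g) (hint f g')]
      refine integral_congr_ae ?_
      filter_upwards [Lp.coeFn_add g g'] with ξ h
      rw [h, Pi.add_apply]; ring)
    (fun a f g => by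
      rw [← integral_smul]
      refine integral_congr_ae ?_
      filter_upwards [Lp.coeFn_smul a g] with ξ h
      rw [h, Pi.smul_apply, smul_eq_mul, smul_eq_mul]; ring)) 1
    (fun f g => by simpa using norm_integral_mul_mul_le c hc f g)

theorem weightedPairing_apply (c : Rd d → ℂ) (hcm : Measurable c) (hc : ∀ ξ, ‖c ξ‖ ≤ 1)
    (f g : L2C d) : weightedPairing c hcm hc f g = ∫ ξ, c ξ * (f ξ * g ξ) := rfl

/-- Reflection about `x / 2`. -/
noncomputable def reflectL2 (x : Rd d) (g : L2C d) : L2C d :=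
  Lp.compMeasurePreserving (fun t => x - t) (Measure.measurePreserving_sub_left volume x) g

theorem continuous_reflectL2 (x : Rd d) : Continuous (reflectL2 x) :=
  (Lp.isometry_compMeasurePreserving (Measure.measurePreserving_sub_left volume x)).continuous

theorem reflectL2_ae (x : Rd d) (g : L2C d) : reflectL2 x g =ᵐ[volume] fun t => g (x - t) :=
  Lp.coeFn_compMeasurePreserving g (Measure.measurePreserving_sub_left volume x)

theorem conv_eq_weightedPairing (f g : L2C d) (x : Rd d) :
    conv f g x = weightedPairing (fun _ => 1) measurable_const (by simp) f (reflectL2 x g) := by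
  rw [weightedPairing_apply, conv, convolution]
  refine integral_congr_ae ?_
  filter_upwards [reflectL2_ae x g] with t ht
  simp [ht]

theorem conv_congr_schwartz (φ γ : 𝓢(Rd d, ℂ)) (x : Rd d) :
    conv (φ.toLp 2) (γ.toLp 2) x
      = SchwartzMap.convolution (ContinuousLinearMap.mul ℂ ℂ) φ γ x := by
  rw [SchwartzMap.convolution_apply, conv, convolution, convolution]
  refine integral_congr_ae ?_
  have h := (Measure.measurePreserving_sub_left (volume : Measure (Rd d)) x).quasiMeasurePreserving.ae_eq_comp
    (γ.coeFn_toLp 2 volume)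
  filter_upwards [φ.coeFn_toLp 2, h] with t h1 h2
  simp only [Function.comp_apply] at h2
  simp [h1, h2]

theorem fourierInv_eq_weightedPairing (f g : L2C d) (x : Rd d) :
    𝓕⁻ (fun ξ => f ξ * g ξ) x = weightedPairing
      (fun ξ => Complex.exp ((2 * Real.pi * inner ℝ ξ x : ℝ) * Complex.I)) (by fun_prop)
      (fun ξ => (Complex.norm_exp_ofReal_mul_I _).le) f g := by
  rw [weightedPairing_apply, Real.fourierInv_eq']
  rfl

/-- The convolution theorem for `L²` functions. -/
theorem conv_eq_fourierInv (f g : L2C d) (x : Rd d) :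
    conv f g x = 𝓕⁻ (fun ξ => (𝓕 f : L2C d) ξ * (𝓕 g : L2C d) ξ) x := by
  rw [conv_eq_weightedPairing, fourierInv_eq_weightedPairing]
  have hF : Continuous fun u : L2C d => (𝓕 u : L2C d) := (Lp.fourierTransformₗᵢ (Rd d) ℂ).continuous
  -- Both sides are continuous bilinear expressions in `(f, g)`, so the Schwartz case suffices.
  have hdense := SchwartzMap.denseRange_toLpCLM (F := ℂ) (p := 2)
    (μ := (volume : Measure (Rd d))) ENNReal.ofNat_ne_top
  refine hdense.induction_on₂ (p := fun f g => weightedPairing (fun _ => 1) measurable_const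
    (by simp) f (reflectL2 x g) = weightedPairing
      (fun ξ => Complex.exp ((2 * Real.pi * inner ℝ ξ x : ℝ) * Complex.I)) (by fun_prop)
      (fun ξ => (Complex.norm_exp_ofReal_mul_I _).le) (𝓕 f : L2C d) (𝓕 g : L2C d)) ?_ ?_ f g
  · refine isClosed_eq ?_ ?_
    · exact (ContinuousLinearMap.continuous₂ _).comp
        (continuous_fst.prodMk ((continuous_reflectL2 x).comp continuous_snd))
    · exact (ContinuousLinearMap.continuous₂ _).comp
        ((hF.comp continuous_fst).prodMk (hF.comp continuous_snd))
  · intro φ γ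
    rw [← conv_eq_weightedPairing, ← fourierInv_eq_weightedPairing]
    change conv (φ.toLp 2) (γ.toLp 2) x
      = 𝓕⁻ (fun ξ => (𝓕 (φ.toLp 2) : L2C d) ξ * (𝓕 (γ.toLp 2) : L2C d) ξ) x
    rw [conv_congr_schwartz, SchwartzMap.toLp_fourier_eq, SchwartzMap.toLp_fourier_eq]
    have h : SchwartzMap.convolution (ContinuousLinearMap.mul ℂ ℂ) φ γ
        = 𝓕⁻ (𝓕 (SchwartzMap.convolution (ContinuousLinearMap.mul ℂ ℂ) φ γ)) := by simp
    rw [h, SchwartzMap.fourier_convolution, SchwartzMap.fourierInv_coe, Real.fourierInv_eq',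
      Real.fourierInv_eq']
    refine integral_congr_ae ?_
    filter_upwards [(𝓕 φ).coeFn_toLp 2, (𝓕 γ).coeFn_toLp 2] with ξ h1 h2
    rw [h1, h2]
    simp

/-- Smooth compactly supported functions as Schwartz functions. -/
theorem exists_schwartz_eq {g : Rd d → ℝ} (hg : ContDiff ℝ ((⊤ : ℕ∞) : WithTop ℕ∞) g)
    (hs : HasCompactSupport g) : ∃ φ : 𝓢(Rd d, ℂ), ∀ x, φ x = (g x : ℂ) :=
  ⟨HasCompactSupport.toSchwartzMap (f := fun x => (g x : ℂ))
    (hs.comp_left (g := fun r : ℝ => (r : ℂ)) Complex.ofReal_zero)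
    (Complex.ofRealCLM.contDiff.comp hg), fun _ => rfl⟩

theorem ae_eq_of_integral_schwartz_mul_eq {u v : Rd d → ℂ} (hu : LocallyIntegrable u)
    (hv : LocallyIntegrable v) (h : ∀ φ : 𝓢(Rd d, ℂ), ∫ ξ, φ ξ * u ξ = ∫ ξ, φ ξ * v ξ) :
    u =ᵐ[volume] v := by
  refine ae_eq_of_integral_contDiff_smul_eq hu hv fun g hg hs => ?_
  obtain ⟨φ, hφ⟩ := exists_schwartz_eq hg hs
  simpa only [hφ, Complex.real_smul] using h φ

theorem integral_schwartz_mul_fourier {u : Rd d → ℂ} (hu : Integrable u) (φ : 𝓢(Rd d, ℂ)) :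
    ∫ ξ, φ ξ * 𝓕 u ξ = ∫ x, 𝓕 φ x * u x := by
  have := VectorFourier.integral_fourierIntegral_smul_eq_flip (μ := (volume : Measure (Rd d)))
    (ν := (volume : Measure (Rd d))) (L := innerₗ (Rd d)) (f := u) (g := φ)
    Real.continuous_fourierChar continuous_inner hu φ.integrable
  simp only [smul_eq_mul, flip_innerₗ] at this
  simp only [mul_comm (φ _), SchwartzMap.fourier_coe, mul_comm _ (u _)]
  exact this

/-- The integrable functions with vanishing inverse Fourier integral vanish almost everywhere. -/
theorem ae_eq_zero_of_fourierInv_eq_zero {u : Rd d → ℂ} (hu : Integrable u)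
    (h : ∀ x, 𝓕⁻ u x = 0) : u =ᵐ[volume] 0 := by
  have h0 : 𝓕 u = 0 := by
    ext x
    have := h (-x)
    rwa [Real.fourierInv_eq_fourier_neg, neg_neg] at this
  refine ae_eq_of_integral_schwartz_mul_eq hu.locallyIntegrable
    (integrable_zero _ _ _).locallyIntegrable fun φ => ?_
  have := integral_schwartz_mul_fourier hu (𝓕⁻ φ)
  rw [h0, FourierTransform.fourier_fourierInv_eq] at this
  simpa using this.symm

/-- On `L¹ ∩ L²` the Plancherel transform is given by the Fourier integral. -/
theorem fourier_ae_eq_of_integrable (f : L2C d) (hf : Integrable f) :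
    (𝓕 f : L2C d) =ᵐ[volume] 𝓕 (f : Rd d → ℂ) := by
  have hcont : Continuous (𝓕 (f : Rd d → ℂ)) :=
    VectorFourier.fourierIntegral_continuous Real.continuous_fourierChar continuous_inner hf
  refine ae_eq_of_integral_schwartz_mul_eq ((Lp.memLp _).locallyIntegrable (by norm_num))
    hcont.locallyIntegrable fun φ => ?_
  rw [integral_schwartz_mul_fourier hf]
  -- The two transforms are compared as tempered distributions.
  have h := DFunLike.congr_fun (Lp.fourier_toTemperedDistribution_eq f) φ
  simpa [mul_comm] using h.symm

end FourierL2

/-! ### Uniqueness from integer frequencies -/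

section Sampling

variable {d : ℕ} {Ω : Type*} [MeasurableSpace Ω] {μ : Measure Ω}

/-- If the pushforward of the complex measure `Γ μ` to the torus has vanishing Fourier
coefficients, it vanishes against all continuous functions. -/
theorem integral_mul_torus_eq_zero {Γ : Ω → ℂ} (hΓ : Integrable Γ μ) {q : Ω → UnitAddTorus (Fin d)}
    (hq : Measurable q) (h : ∀ n, ∫ ω, Γ ω * UnitAddTorus.mFourier n (q ω) ∂μ = 0)
    (φ : C(UnitAddTorus (Fin d), ℂ)) : ∫ ω, Γ ω * φ (q ω) ∂μ = 0 := by
  have hint : ∀ φ : C(UnitAddTorus (Fin d), ℂ), Integrable (fun ω => Γ ω * φ (q ω)) μ := fun φ =>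
    hΓ.mul_bdd (c := ‖φ‖) (φ.continuous.measurable.comp hq).aestronglyMeasurable
      (Filter.Eventually.of_forall fun ω => φ.norm_coe_le_norm _)
  let T : C(UnitAddTorus (Fin d), ℂ) →L[ℂ] ℂ := LinearMap.mkContinuous
    { toFun := fun φ => ∫ ω, Γ ω * φ (q ω) ∂μ
      map_add' := fun φ φ' => by
        rw [← integral_add (hint φ) (hint φ')]
        simp only [ContinuousMap.add_apply, mul_add]
      map_smul' := fun a φ => by
        rw [RingHom.id_apply, ← integral_smul]
        simp only [ContinuousMap.smul_apply, smul_eq_mul, mul_left_comm] }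
    (∫ ω, ‖Γ ω‖ ∂μ) (fun φ => by
      rw [← integral_mul_const]
      refine norm_integral_le_of_norm_le (hΓ.norm.mul_const _)
        (Filter.Eventually.of_forall fun ω => ?_)
      rw [norm_mul]
      gcongr
      exact φ.norm_coe_le_norm _)
  have h1 : Submodule.span ℂ (Set.range (UnitAddTorus.mFourier (d := Fin d))) ≤ T.ker := by
    rw [Submodule.span_le]
    rintro _ ⟨n, rfl⟩
    exact h n
  have h2 := Submodule.topologicalClosure_minimal _ h1 T.isClosed_ker
  -- Trigonometric polynomials are dense, and the kernel of `T` is closed.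
  rw [UnitAddTorus.span_mFourier_closure_eq_top] at h2
  exact h2 (Submodule.mem_top (x := φ))

/-- A continuous cutoff of the open interval `(-1/2, 1/2)`. -/
noncomputable def cutoff (k : ℕ) (t : ℝ) : ℝ := min 1 (k * max 0 (1 / 2 - |t|))

theorem cutoff_nonneg (k : ℕ) (t : ℝ) : 0 ≤ cutoff k t := by
  unfold cutoff; positivity

theorem cutoff_le_one (k : ℕ) (t : ℝ) : cutoff k t ≤ 1 := min_le_left _ _

theorem continuous_cutoff (k : ℕ) : Continuous (cutoff k) := by
  unfold cutoff; fun_prop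

theorem tendsto_cutoff {t : ℝ} (ht : |t| < 1 / 2) :
    Filter.Tendsto (fun k => cutoff k t) Filter.atTop (𝓝 1) := by
  refine tendsto_const_nhds.congr' ?_
  obtain ⟨N, hN⟩ := exists_nat_ge (1 / (1 / 2 - |t|))
  filter_upwards [Filter.eventually_ge_atTop N] with k hk
  have hpos : 0 < 1 / 2 - |t| := by linarith
  rw [cutoff, max_eq_right hpos.le, min_eq_left]
  rw [← div_le_iff₀ hpos]
  exact hN.trans (by exact_mod_cast hk)

/-- A continuous function on the circle that agrees on `(-1/2, 1/2)` with a cutoff of the character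
of frequency `y`. -/
noncomputable def cutoffCharacter (k : ℕ) (y : ℝ) : C(UnitAddCircle, ℂ) where
  toFun := AddCircle.liftIco 1 (-(1 / 2)) fun t : ℝ =>
    (cutoff k t : ℂ) * Complex.exp ((2 * Real.pi * (y * t) : ℝ) * Complex.I)
  continuous_toFun := by
    refine AddCircle.liftIco_continuous ?_ (Continuous.continuousOn ?_)
    · rw [show (-(1 / 2) + 1 : ℝ) = 1 / 2 by norm_num]
      simp [cutoff, abs_of_pos]
    · have := continuous_cutoff k
      fun_prop

theorem cutoffCharacter_coe (k : ℕ) (y : ℝ) {t : ℝ} (ht : |t| < 1 / 2) :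
    cutoffCharacter k y (t : UnitAddCircle)
      = (cutoff k t : ℂ) * Complex.exp ((2 * Real.pi * (y * t) : ℝ) * Complex.I) := by
  rw [abs_lt] at ht
  have hmem : t ∈ Set.Ico (-(1 / 2) : ℝ) (-(1 / 2) + 1) := ⟨ht.1.le, by linarith [ht.2]⟩
  exact AddCircle.liftIco_coe_apply (p := (1 : ℝ)) (f := fun t : ℝ =>
    (cutoff k t : ℂ) * Complex.exp ((2 * Real.pi * (y * t) : ℝ) * Complex.I)) hmem

/-- If an integrable density, pushed forward by a map into the open unit cube, has a Fourier
transform that vanishes at all integer points, then its Fourier transform vanishes identically. -/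
theorem integral_mul_cexp_eq_zero_of_int {Γ : Ω → ℂ} (hΓ : Integrable Γ μ) {p : Ω → Fin d → ℝ}
    (hp : Measurable p) (hcube : ∀ᵐ ω ∂μ, Γ ω ≠ 0 → ∀ i, |p ω i| < 1 / 2)
    (h : ∀ n : Fin d → ℤ,
      ∫ ω, Γ ω * Complex.exp ((2 * Real.pi * ∑ i, n i * p ω i : ℝ) * Complex.I) ∂μ = 0)
    (y : Fin d → ℝ) :
    ∫ ω, Γ ω * Complex.exp ((2 * Real.pi * ∑ i, y i * p ω i : ℝ) * Complex.I) ∂μ = 0 := by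
  have hprod : ∀ (z w : Fin d → ℝ),
      Complex.exp ((2 * Real.pi * ∑ i, z i * w i : ℝ) * Complex.I)
        = ∏ i, Complex.exp ((2 * Real.pi * (z i * w i) : ℝ) * Complex.I) := by
    intro z w
    rw [← Complex.exp_sum, ← Finset.sum_mul, ← Complex.ofReal_sum, Finset.mul_sum]
  have hq : Measurable fun ω => (fun i => (p ω i : UnitAddCircle) : UnitAddTorus (Fin d)) := by
    refine measurable_pi_lambda _ fun i => ?_
    exact (AddCircle.measurable_mk' (a := (1 : ℝ))).comp ((measurable_pi_apply i).comp hp)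
  have h1 := integral_mul_torus_eq_zero hΓ hq fun n => by
    rw [← h n]
    congr 1
    ext ω
    congr 1
    rw [hprod (fun i => (n i : ℝ))]
    simp only [UnitAddTorus.mFourier, ContinuousMap.coe_mk, fourier_coe_apply]
    refine Finset.prod_congr rfl fun i _ => ?_
    congr 1
    push_cast
    ring
  have h2 : ∀ k : ℕ, ∫ ω, Γ ω * ∏ i, cutoffCharacter k (y i) (p ω i : UnitAddCircle) ∂μ = 0 :=
    fun k => h1 ⟨fun x => ∏ i, cutoffCharacter k (y i) (x i), by fun_prop⟩
  have hval : ∀ᵐ ω ∂μ, ∀ k : ℕ, Γ ω * ∏ i, cutoffCharacter k (y i) (p ω i : UnitAddCircle)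
      = Γ ω * ∏ i, ((cutoff k (p ω i) : ℂ)
          * Complex.exp ((2 * Real.pi * (y i * p ω i) : ℝ) * Complex.I)) := by
    filter_upwards [hcube] with ω hω k
    by_cases h0 : Γ ω = 0
    · simp [h0]
    · congr 1
      exact Finset.prod_congr rfl fun i _ => cutoffCharacter_coe k (y i) (hω h0 i)
  -- As `k → ∞` the cutoffs tend to `1` on the open cube, where `Γ` is concentrated, with dominating
  -- function `‖Γ‖`.
  have h3 := tendsto_integral_of_dominated_convergence (μ := μ)
    (F := fun (k : ℕ) ω => Γ ω * ∏ i, cutoffCharacter k (y i) (p ω i : UnitAddCircle))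
    (f := fun ω => Γ ω * Complex.exp ((2 * Real.pi * ∑ i, y i * p ω i : ℝ) * Complex.I))
    (fun ω => ‖Γ ω‖) (fun k => ?_) hΓ.norm (fun k => ?_) ?_
  · simp only [h2] at h3
    exact (tendsto_nhds_unique h3 tendsto_const_nhds)
  · have hcont : Continuous fun x : UnitAddTorus (Fin d) =>
        ∏ i, cutoffCharacter k (y i) (x i) := by fun_prop
    exact hΓ.aestronglyMeasurable.mul (hcont.measurable.comp hq).aestronglyMeasurable
  · filter_upwards [hval] with ω hω
    rw [hω, norm_mul, norm_prod]
    refine mul_le_of_le_one_right (norm_nonneg _) (Finset.prod_le_one (fun _ _ => norm_nonneg _) ?_)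
    intro i _
    rw [norm_mul, Complex.norm_exp_ofReal_mul_I, mul_one, Complex.norm_real,
      Real.norm_of_nonneg (cutoff_nonneg _ _)]
    exact cutoff_le_one _ _
  · filter_upwards [hval, hcube] with ω hω hc
    simp only [hω]
    by_cases h0 : Γ ω = 0
    · simp [h0]
    rw [hprod]
    refine Filter.Tendsto.const_mul _ (tendsto_finsetProd _ fun i _ => ?_)
    have := (Complex.continuous_ofReal.tendsto 1).comp (tendsto_cutoff (hc h0 i))
    simpa using this.mul_const (Complex.exp ((2 * Real.pi * (y i * p ω i) : ℝ) * Complex.I))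

end Sampling

/-! ### Passing between real and complex `L²` -/

section Complexification

variable {d : ℕ}

theorem toComplex_ae (f : L2R d) : toComplex f =ᵐ[volume] fun x => (f x : ℂ) :=
  Complex.ofRealCLM.coeFn_compLp f

theorem toComplex_sub (f g : L2R d) : toComplex (f - g) = toComplex f - toComplex g :=
  map_sub (Complex.ofRealCLM.compLpL 2 (volume : Measure (Rd d))) f g

theorem toComplex_add (f g : L2R d) : toComplex (f + g) = toComplex f + toComplex g :=
  map_add (Complex.ofRealCLM.compLpL 2 (volume : Measure (Rd d))) f g

theorem toComplex_eq_zero {f : L2R d} (h : toComplex f = 0) : f = 0 := by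
  rw [Lp.eq_zero_iff_ae_eq_zero] at h ⊢
  filter_upwards [h, toComplex_ae f] with x h1 h2
  rw [h1] at h2
  exact (Complex.ofReal_eq_zero.1 h2.symm)

theorem conv_toComplex (f g : L2R d) (x : Rd d) :
    conv (toComplex f) (toComplex g) x = ((conv f g x : ℝ) : ℂ) := by
  rw [conv, conv, convolution, convolution, ← integral_complex_ofReal]
  refine integral_congr_ae ?_
  have h := (Measure.measurePreserving_sub_left (volume : Measure (Rd d))
    x).quasiMeasurePreserving.ae_eq_comp (toComplex_ae g)
  filter_upwards [toComplex_ae f, h] with t h1 h2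
  simp only [Function.comp_apply] at h2
  simp [h1, h2]

theorem conv_sub_left (f f' g : L2C d) (x : Rd d) :
    conv (f - f') g x = conv f g x - conv f' g x := by
  simp [conv_eq_weightedPairing]

theorem conv_add_left (f f' g : L2C d) (x : Rd d) :
    conv (f + f') g x = conv f g x + conv f' g x := by
  simp [conv_eq_weightedPairing]

/-- The product of the Fourier transforms of two real-valued `L²` functions. -/
noncomputable def fourierProd (f ψ : L2R d) (ξ : Rd d) : ℂ := fourierL2 f ξ * fourierL2 ψ ξ

theorem integrable_fourierProd (f ψ : L2R d) : Integrable (fourierProd f ψ) :=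
  integrable_mul_of_L2 _ _

theorem ofReal_conv_eq_fourierInv (f ψ : L2R d) (x : Rd d) :
    ((conv f ψ x : ℝ) : ℂ) = 𝓕⁻ (fourierProd f ψ) x := by
  rw [← conv_toComplex, conv_eq_fourierInv]
  rfl

theorem IsSemiDiscreteFrame.eq_zero {Λ : Type*} {ψ : Λ → L2R d} (hψ : IsSemiDiscreteFrame ψ)
    {g : L2C d} (hg : ∀ l x, conv g (toComplex (ψ l)) x = 0) : g = 0 := by
  obtain ⟨A, B, hA, -, h⟩ := hψ
  have h1 := (h g).1
  have h2 : ∀ l, conv g (toComplex (ψ l)) = 0 := fun l => funext (hg l)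
  simp only [h2, eLpNorm_zero, ne_eq, OfNat.ofNat_ne_zero, not_false_eq_true, zero_pow, tsum_zero,
    nonpos_iff_eq_zero, mul_eq_zero, pow_eq_zero_iff] at h1
  rcases h1 with h1 | h1
  · exact absurd (ENNReal.ofReal_eq_zero.1 h1) (not_le.2 hA)
  · rw [Lp.eq_zero_iff_ae_eq_zero]
    exact (eLpNorm_eq_zero_iff (Lp.aestronglyMeasurable g) (by simp)).1 h1

end Complexification

/-! ### Essential supports and the faces of the parallelepiped -/

section Support

variable {d : ℕ}

theorem ae_mem_essSupport (g : Rd d → ℂ) : ∀ᵐ ξ, g ξ ≠ 0 → ξ ∈ essSupport g := by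
  have h : volume (Function.support g \ essSupport g) = 0 := by
    refine measure_null_of_locally_null _ fun ξ hξ => ?_
    have h1 := hξ.2
    simp only [essSupport, Set.mem_ofPred_eq, not_forall, not_not] at h1
    obtain ⟨V, hV, hV0⟩ := h1
    refine ⟨V ∩ Function.support g, ?_, hV0⟩
    exact Filter.inter_mem (mem_nhdsWithin_of_mem_nhds hV)
      (Filter.mem_of_superset self_mem_nhdsWithin Set.sdiff_subset)
  rw [ae_iff]
  convert h using 2
  ext ξ
  simp

theorem ae_mem_freqSupport (f ψ : L2R d) :
    ∀ᵐ ξ, fourierProd f ψ ξ ≠ 0 → ξ ∈ freqSupport ψ := by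
  filter_upwards [ae_mem_essSupport (fourierL2 ψ : Rd d → ℂ)] with ξ h h0
  exact h (right_ne_zero_of_mul h0)

/-- On a bounded spectrum the weight `exp ‖ξ‖` is bounded, so integrability of `G` is all the decay
needed. -/
theorem lineAnalytic_fourierInv_of_isCompact {G : Rd d → ℂ} (hG : Integrable G) {F : Set (Rd d)}
    (hF : IsCompact F) (hGF : ∀ᵐ ξ, G ξ ≠ 0 → ξ ∈ F) : LineAnalytic (𝓕⁻ G) := by
  obtain ⟨R, hR⟩ := hF.isBounded.exists_norm_le
  have h : LineAnalytic (𝓕 G) := by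
    refine lineAnalytic_fourier one_pos hG.aestronglyMeasurable ?_
    refine (hG.norm.mul_const (Real.exp R)).mono' ?_ ?_
    · exact hG.aestronglyMeasurable.norm.mul
        (by fun_prop : Measurable fun ξ : Rd d => Real.exp (1 * ‖ξ‖)).aestronglyMeasurable
    · filter_upwards [hGF] with ξ hξ
      by_cases h0 : G ξ = 0
      · simp [h0]
      · rw [norm_mul, norm_norm, Real.norm_of_nonneg (Real.exp_nonneg _), one_mul]
        gcongr
        exact hR ξ (hξ h0)
  have h' : (𝓕⁻ G : Rd d → ℂ) = fun x => 𝓕 G (-x) :=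
    funext fun x => Real.fourierInv_eq_fourier_neg G x
  rw [h']
  exact h.comp_neg

/-- Almost every frequency in the parallelepiped `M [-1/2, 1/2]^d` is an interior point of it. -/
theorem ae_abs_lt_of_mem_imageCube {M : Matrix (Fin d) (Fin d) ℝ} (hM : IsUnit M.det) :
    ∀ᵐ ξ : Rd d, ξ ∈ imageCube M → ∀ i, |(M⁻¹ *ᵥ ξ.ofLp) i| < 1 / 2 := by
  have hnull : ∀ (i : Fin d) (c : ℝ), c ≠ 0 → ∀ᵐ ξ : Rd d, (M⁻¹ *ᵥ ξ.ofLp) i ≠ c := by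
    intro i c hc
    have hlin : ∀ (x v : Rd d) (t : ℝ), (M⁻¹ *ᵥ (x + t • v).ofLp) i
        = (M⁻¹ *ᵥ x.ofLp) i + t * (M⁻¹ *ᵥ v.ofLp) i := by
      intro x v t
      simp [Matrix.mulVec_add, Matrix.mulVec_smul]
    have ha : LineAnalytic fun ξ : Rd d => (((M⁻¹ *ᵥ ξ.ofLp) i - c : ℝ) : ℂ) := by
      intro x v
      simp only [hlin]
      intro t _
      refine AnalyticAt.fun_comp (g := fun r : ℝ => (r : ℂ)) (f := fun t : ℝ =>
        (M⁻¹ *ᵥ x.ofLp) i + t * (M⁻¹ *ᵥ v.ofLp) i - c) (Complex.ofRealCLM.analyticAt _) ?_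
      exact (analyticAt_const.add (analyticAt_id.mul analyticAt_const)).sub analyticAt_const
    have hm : Measurable fun ξ : Rd d => (((M⁻¹ *ᵥ ξ.ofLp) i - c : ℝ) : ℂ) := by
      simp only [Matrix.mulVec, dotProduct]
      fun_prop
    -- The affine function takes the value `-c ≠ 0` at the origin, so its zero hyperplane is null.
    have := ha.measure_zeros_eq_zero volume hm (x := 0) (by simpa using hc)
    rw [ae_iff]
    convert this using 2
    ext ξ
    simp only [Set.mem_ofPred_eq, not_not]
    rw [Complex.ofReal_eq_zero, sub_eq_zero]
  have h1 : ∀ᵐ ξ : Rd d, ∀ i, (M⁻¹ *ᵥ ξ.ofLp) i ≠ 1 / 2 ∧ (M⁻¹ *ᵥ ξ.ofLp) i ≠ -(1 / 2) :=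
    ae_all_iff.2 fun i => (hnull i _ (by norm_num)).and (hnull i _ (by norm_num))
  filter_upwards [h1] with ξ hξ hcube i
  obtain ⟨t, ht, rfl⟩ := hcube
  have hi := hξ i
  simp only [Matrix.mulVec_mulVec, Matrix.nonsing_inv_mul M hM, Matrix.one_mulVec] at hi ⊢
  rw [abs_lt]
  exact ⟨lt_of_le_of_ne (ht i).1 hi.2.symm, lt_of_le_of_ne (ht i).2 hi.1⟩

end Support

/-! ### Sampling the square of a band-limited function -/

section Lattice

variable {d : ℕ}

/-- The point `(Mᵀ)⁻¹ D[2s]⁻¹ y`. -/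
noncomputable def latticePoint (M : Matrix (Fin d) (Fin d) ℝ) (s y : Fin d → ℝ) : Rd d :=
  WithLp.toLp 2 ((Mᵀ)⁻¹ *ᵥ ((Matrix.diagonal fun i => 2 * s i)⁻¹ *ᵥ y))

theorem inv_diagonal_two_mul {s : Fin d → ℝ} (hs : ∀ i, 1 ≤ s i) :
    (Matrix.diagonal fun i => 2 * s i)⁻¹ = Matrix.diagonal fun i => (2 * s i)⁻¹ := by
  refine Matrix.inv_eq_right_inv ?_
  rw [Matrix.diagonal_mul_diagonal, ← Matrix.diagonal_one]
  congr 1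
  ext i
  exact mul_inv_cancel₀ (by linarith [hs i])

theorem inner_latticePoint (M : Matrix (Fin d) (Fin d) ℝ) {s : Fin d → ℝ} (hs : ∀ i, 1 ≤ s i)
    (y : Fin d → ℝ) (ξ : Rd d) :
    inner ℝ ξ (latticePoint M s y) = ∑ i, y i * ((2 * s i)⁻¹ * (M⁻¹ *ᵥ ξ.ofLp) i) := by
  have h : inner ℝ ξ (latticePoint M s y)
      = ((Mᵀ)⁻¹ *ᵥ ((Matrix.diagonal fun i => 2 * s i)⁻¹ *ᵥ y)) ⬝ᵥ ξ.ofLp := by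
    simp [latticePoint, PiLp.inner_apply, dotProduct]
  rw [h, inv_diagonal_two_mul hs, ← Matrix.transpose_nonsing_inv, Matrix.mulVec_transpose,
    ← Matrix.dotProduct_mulVec, dotProduct]
  refine Finset.sum_congr rfl fun i _ => ?_
  rw [Matrix.mulVec_diagonal]
  ring

theorem exists_latticePoint_eq {M : Matrix (Fin d) (Fin d) ℝ} (hM : IsUnit M.det) {s : Fin d → ℝ}
    (hs : ∀ i, 1 ≤ s i) (x : Rd d) : ∃ y, latticePoint M s y = x := by
  refine ⟨(Matrix.diagonal fun i => 2 * s i) *ᵥ (Mᵀ *ᵥ x.ofLp), ?_⟩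
  have hD : IsUnit (Matrix.diagonal fun i => 2 * s i).det := by
    rw [Matrix.det_diagonal, isUnit_iff_ne_zero, Finset.prod_ne_zero_iff]
    intro i _
    linarith [hs i]
  have hMt : IsUnit (Mᵀ).det := by rwa [Matrix.det_transpose]
  rw [latticePoint, Matrix.mulVec_mulVec _ _ (Matrix.diagonal _), Matrix.nonsing_inv_mul _ hD,
    Matrix.one_mulVec, Matrix.mulVec_mulVec, Matrix.nonsing_inv_mul _ hMt, Matrix.one_mulVec]

/-- Keeping the square as an integral over pairs of frequencies avoids forming `G ∗ G` and its
support; lattice points correspond to integer `y`. -/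
theorem sq_fourierInv_latticePoint {M : Matrix (Fin d) (Fin d) ℝ} {s : Fin d → ℝ}
    (hs : ∀ i, 1 ≤ s i) (G : Rd d → ℂ) (y : Fin d → ℝ) :
    𝓕⁻ G (latticePoint M s y) ^ 2 = ∫ q : Rd d × Rd d, G q.1 * G q.2 * Complex.exp
      ((2 * Real.pi * ∑ i, y i * ((2 * s i)⁻¹ * (M⁻¹ *ᵥ q.1.ofLp) i
        + (2 * s i)⁻¹ * (M⁻¹ *ᵥ q.2.ofLp) i) : ℝ) * Complex.I) := by
  rw [pow_two, Real.fourierInv_eq', ← integral_prod_mul, Measure.volume_eq_prod]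
  congr 1
  ext q
  rw [inner_latticePoint M hs, inner_latticePoint M hs]
  simp only [mul_add (_ : ℝ) (_ * _) (_ * _), Finset.sum_add_distrib, smul_eq_mul]
  rw [mul_add, Complex.ofReal_add, add_mul, Complex.exp_add]
  ring

/-- Sampling for squares: the squares of two functions with spectrum in `M [-1/2, 1/2]^d` agree if
they agree on the lattice `(Mᵀ)⁻¹ D[2s]⁻¹ ℤ^d`. -/
theorem sq_fourierInv_eq_of_lattice {M : Matrix (Fin d) (Fin d) ℝ} (hM : IsUnit M.det)
    {s : Fin d → ℝ} (hs : ∀ i, 1 ≤ s i) {G H : Rd d → ℂ} (hG : Integrable G) (hH : Integrable H)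
    (hGM : ∀ᵐ ξ, G ξ ≠ 0 → ξ ∈ imageCube M) (hHM : ∀ᵐ ξ, H ξ ≠ 0 → ξ ∈ imageCube M)
    (h : ∀ x ∈ samplingLattice M s, 𝓕⁻ G x ^ 2 = 𝓕⁻ H x ^ 2) (x : Rd d) :
    𝓕⁻ G x ^ 2 = 𝓕⁻ H x ^ 2 := by
  set P : Rd d × Rd d → Fin d → ℝ := fun q i => (2 * s i)⁻¹ * (M⁻¹ *ᵥ q.1.ofLp) i
    + (2 * s i)⁻¹ * (M⁻¹ *ᵥ q.2.ofLp) i with hP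
  have hPm : Measurable P := by
    refine measurable_pi_lambda _ fun i => ?_
    simp only [hP, Matrix.mulVec, dotProduct]
    fun_prop
  have hprod : ∀ {K : Rd d → ℂ}, Integrable K →
      Integrable (fun q : Rd d × Rd d => K q.1 * K q.2) := fun hK => hK.mul_prod hK
  have hΓ : Integrable (fun q : Rd d × Rd d => G q.1 * G q.2 - H q.1 * H q.2) :=
    (hprod hG).sub (hprod hH)
  have hsub : ∀ y : Fin d → ℝ,
      ∫ q : Rd d × Rd d, (G q.1 * G q.2 - H q.1 * H q.2) * Complex.exp
        ((2 * Real.pi * ∑ i, y i * P q i : ℝ) * Complex.I)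
      = 𝓕⁻ G (latticePoint M s y) ^ 2 - 𝓕⁻ H (latticePoint M s y) ^ 2 := by
    intro y
    have hint : ∀ {K : Rd d → ℂ}, Integrable K →
        Integrable (fun q : Rd d × Rd d => K q.1 * K q.2 * Complex.exp
          ((2 * Real.pi * ∑ i, y i * P q i : ℝ) * Complex.I)) := by
      intro K hK
      refine (hprod hK).mul_bdd (c := 1) ?_
        (Filter.Eventually.of_forall fun q => (Complex.norm_exp_ofReal_mul_I _).le)
      have : ∀ i, Measurable fun q => P q i := fun i => (measurable_pi_apply i).comp hPm
      exact Measurable.aestronglyMeasurable (by fun_prop)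
    rw [sq_fourierInv_latticePoint hs, sq_fourierInv_latticePoint hs,
      ← integral_sub (hint hG) (hint hH)]
    simp only [sub_mul, hP]
  -- Each normalized coordinate is below `1/2` in modulus off a null set, so a sum of two is below
  -- `1`, and `(2 s_i)⁻¹ ≤ 1/2` brings it into the open cube.
  have hcube : ∀ᵐ q : Rd d × Rd d, G q.1 * G q.2 - H q.1 * H q.2 ≠ 0 → ∀ i, |P q i| < 1 / 2 := by
    have hK : ∀ᵐ ξ, (G ξ ≠ 0 ∨ H ξ ≠ 0) → ∀ i, |(M⁻¹ *ᵥ ξ.ofLp) i| < 1 / 2 := by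
      filter_upwards [hGM, hHM, ae_abs_lt_of_mem_imageCube hM] with ξ h1 h2 h3 h4
      exact h3 (h4.elim h1 h2)
    have hq1 := (Measure.quasiMeasurePreserving_fst (μ := (volume : Measure (Rd d)))
      (ν := (volume : Measure (Rd d)))).ae hK
    have hq2 := (Measure.quasiMeasurePreserving_snd (μ := (volume : Measure (Rd d)))
      (ν := (volume : Measure (Rd d)))).ae hK
    rw [← Measure.volume_eq_prod] at hq1 hq2
    filter_upwards [hq1, hq2] with q h1 h2 hne i
    have h3 : (G q.1 ≠ 0 ∨ H q.1 ≠ 0) ∧ (G q.2 ≠ 0 ∨ H q.2 ≠ 0) := by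
      constructor <;>
      · by_contra! hcon
        simp [hcon.1, hcon.2] at hne
    have h4 := h1 h3.1 i
    have h5 := h2 h3.2 i
    have hsi := hs i
    have h6 : (2 * s i)⁻¹ ≤ 1 / 2 := by
      rw [inv_le_comm₀ (by linarith) (by norm_num)]
      linarith
    have h7 : 0 < (2 * s i)⁻¹ := inv_pos.2 (by linarith)
    calc |P q i| = (2 * s i)⁻¹ * |(M⁻¹ *ᵥ q.1.ofLp) i + (M⁻¹ *ᵥ q.2.ofLp) i| := by
          simp only [hP]
          rw [← mul_add, abs_mul, abs_of_pos h7]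
      _ ≤ 1 / 2 * |(M⁻¹ *ᵥ q.1.ofLp) i + (M⁻¹ *ᵥ q.2.ofLp) i| := by gcongr
      _ < 1 / 2 := by
          have := abs_add_le ((M⁻¹ *ᵥ q.1.ofLp) i) ((M⁻¹ *ᵥ q.2.ofLp) i)
          linarith
  have key := integral_mul_cexp_eq_zero_of_int hΓ hPm hcube (fun n => by
    rw [hsub fun i => (n i : ℝ), sub_eq_zero]
    exact h _ ⟨n, rfl⟩)
  obtain ⟨y, rfl⟩ := exists_latticePoint_eq hM hs x
  rw [← sub_eq_zero, ← hsub y]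
  exact key y

end Lattice

/-! ### From a sign for each filter to one global sign -/

section Signs

variable {d : ℕ}

/-- Sign retrieval for a single band-limited filter. -/
theorem conv_eq_or_eq_neg {ψ : L2R d} {X : Set (Rd d)}
    (hX : IsSignBlindSamplingSet (freqSupport ψ) X) {f h : L2R d}
    (hfh : ∀ x ∈ X, |conv f ψ x| = |conv h ψ x|) :
    (∀ x, conv f ψ x = conv h ψ x) ∨ ∀ x, conv f ψ x = -conv h ψ x := by
  obtain ⟨hF, M, s, hM, hFM, hs, rfl⟩ := hX
  have hsq := sq_fourierInv_eq_of_lattice hM hs (integrable_fourierProd f ψ)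
    (integrable_fourierProd h ψ)
    ((ae_mem_freqSupport f ψ).mono fun ξ hξ h0 => hFM (hξ h0))
    ((ae_mem_freqSupport h ψ).mono fun ξ hξ h0 => hFM (hξ h0)) fun x hx => by
      rw [← ofReal_conv_eq_fourierInv, ← ofReal_conv_eq_fourierInv]
      exact_mod_cast sq_eq_sq_iff_abs_eq_abs _ _ |>.2 (hfh x hx)
  have hla : ∀ g : L2R d, LineAnalytic (𝓕⁻ (fourierProd g ψ)) := fun g =>
    lineAnalytic_fourierInv_of_isCompact (integrable_fourierProd g ψ) hF (ae_mem_freqSupport g ψ)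
  have hmul := ((hla f).sub (hla h)).eq_zero_or_eq_zero_of_mul_eq_zero ((hla f).add (hla h))
    fun x => by
      simp only [Pi.sub_apply, Pi.add_apply]
      linear_combination hsq x
  simp only [Pi.sub_apply, Pi.add_apply, ← ofReal_conv_eq_fourierInv] at hmul
  refine hmul.imp (fun h0 x => ?_) fun h0 x => ?_
  · exact sub_eq_zero.1 (by exact_mod_cast h0 x)
  · exact eq_neg_of_add_eq_zero_left (by exact_mod_cast h0 x)

/-- Linearity reduces this to injectivity of the Fourier integral on `L¹`, applied to the product
for `f - h`. -/
theorem fourierProd_ae_eq {f h ψ : L2R d} (hfh : ∀ x, conv f ψ x = conv h ψ x) :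
    ∀ᵐ ξ, fourierL2 f ξ * fourierL2 ψ ξ = fourierL2 h ξ * fourierL2 ψ ξ := by
  have hsub : fourierL2 (f - h) = fourierL2 f - fourierL2 h := by
    rw [fourierL2, toComplex_sub]
    exact map_sub (Lp.fourierTransformₗᵢ (Rd d) ℂ) _ _
  have h0 := ae_eq_zero_of_fourierInv_eq_zero (integrable_fourierProd (f - h) ψ) fun x => by
    rw [← ofReal_conv_eq_fourierInv, ← conv_toComplex, toComplex_sub, conv_sub_left,
      conv_toComplex, conv_toComplex, hfh x, sub_self]
  filter_upwards [h0, hsub ▸ Lp.coeFn_sub (fourierL2 f) (fourierL2 h)] with ξ h1 h2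
  rw [fourierProd, h2, Pi.sub_apply, Pi.zero_apply, sub_mul] at h1
  exact sub_eq_zero.1 h1

theorem fourierProd_ae_eq_neg {f h ψ : L2R d} (hfh : ∀ x, conv f ψ x = -conv h ψ x) :
    ∀ᵐ ξ, fourierL2 f ξ * fourierL2 ψ ξ = -(fourierL2 h ξ * fourierL2 ψ ξ) := by
  have hadd : fourierL2 (f + h) = fourierL2 f + fourierL2 h := by
    rw [fourierL2, toComplex_add]
    exact map_add (Lp.fourierTransformₗᵢ (Rd d) ℂ) _ _
  have h0 := ae_eq_zero_of_fourierInv_eq_zero (integrable_fourierProd (f + h) ψ) fun x => by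
    rw [← ofReal_conv_eq_fourierInv, ← conv_toComplex, toComplex_add, conv_add_left,
      conv_toComplex, conv_toComplex, hfh x, Complex.ofReal_neg, neg_add_cancel]
  filter_upwards [h0, hadd ▸ Lp.coeFn_add (fourierL2 f) (fourierL2 h)] with ξ h1 h2
  rw [fourierProd, h2, Pi.add_apply, Pi.zero_apply, add_mul] at h1
  exact eq_neg_of_add_eq_zero_left h1

/-- The Fourier transform of a nonzero exponentially decaying function vanishes almost nowhere. -/
theorem fourierL2_ae_ne_zero {f : L2R d} (hf : ∃ α : ℝ, 0 < α ∧
    Integrable (fun x : Rd d => |f x| * Real.exp (α * ‖x‖)) volume) (hf0 : f ≠ 0) :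
    ∀ᵐ ξ, fourierL2 f ξ ≠ 0 := by
  obtain ⟨α, hα, hint⟩ := hf
  have hm : AEStronglyMeasurable (toComplex f) (volume : Measure (Rd d)) :=
    Lp.aestronglyMeasurable _
  have hint' : Integrable fun x : Rd d => ‖toComplex f x‖ * Real.exp (α * ‖x‖) := by
    refine hint.congr ?_
    filter_upwards [toComplex_ae f] with x hx
    rw [hx, Complex.norm_real, Real.norm_eq_abs]
  have hL1 : Integrable (toComplex f) := by
    refine hint'.mono' hm (Filter.Eventually.of_forall fun x => ?_)
    exact le_mul_of_one_le_right (norm_nonneg _) (Real.one_le_exp (by positivity))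
  have hae := fourier_ae_eq_of_integrable (toComplex f) hL1
  have hla := lineAnalytic_fourier hα hm hint'
  have hcont : Continuous (𝓕 (toComplex f : Rd d → ℂ)) :=
    VectorFourier.fourierIntegral_continuous Real.continuous_fourierChar continuous_inner hL1
  obtain ⟨ξ₀, hξ₀⟩ : ∃ ξ, 𝓕 (toComplex f : Rd d → ℂ) ξ ≠ 0 := by
    by_contra! hcon
    refine hf0 (toComplex_eq_zero ?_)
    have h1 : (𝓕 (toComplex f) : L2C d) = 0 := by
      rw [Lp.eq_zero_iff_ae_eq_zero]
      filter_upwards [hae] with ξ hξ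
      rw [hξ, hcon ξ, Pi.zero_apply]
    exact (map_eq_zero_iff (Lp.fourierTransformₗᵢ (Rd d) ℂ)
      (Lp.fourierTransformₗᵢ (Rd d) ℂ).injective).1 h1
  have hnull := hla.measure_zeros_eq_zero volume hcont.measurable hξ₀
  have hne : ∀ᵐ ξ, 𝓕 (toComplex f : Rd d → ℂ) ξ ≠ 0 := by
    rw [ae_iff]
    simpa using hnull
  filter_upwards [hae, hne] with ξ h1 h2
  rw [fourierL2, h1]
  exact h2

/-- If the signs of two overlapping filters disagreed, `f̂` would vanish where both filters do
not. -/
theorem not_eq_and_eq_neg_of_overlap {f h ψ φ : L2R d} (hf : ∀ᵐ ξ, fourierL2 f ξ ≠ 0)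
    {S : Set (Rd d)} (hS : volume {ξ | ξ ∈ S ∧ fourierL2 ψ ξ ≠ 0 ∧ fourierL2 φ ξ ≠ 0} ≠ 0)
    (hψ : ∀ x, conv f ψ x = conv h ψ x) (hφ : ∀ x, conv f φ x = -conv h φ x) : False := by
  refine hS (measure_eq_zero_iff_ae_notMem.2 ?_)
  filter_upwards [hf, fourierProd_ae_eq hψ, fourierProd_ae_eq_neg hφ] with ξ h0 h1 h2 hξ
  have h3 := mul_right_cancel₀ hξ.2.1 h1
  rw [← neg_mul] at h2
  have h4 := mul_right_cancel₀ hξ.2.2 h2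
  rw [← h3] at h4
  exact h0 (self_eq_neg.1 h4)

theorem forall_conv_eq_or_forall_conv_eq_neg {Λ : Type*} {ψ : Λ → L2R d}
    (hoverlap : HasGoodFSupportOverlap ψ) {f h : L2R d} (hf : ∀ᵐ ξ, fourierL2 f ξ ≠ 0)
    (hfh : ∀ l, (∀ x, conv f (ψ l) x = conv h (ψ l) x) ∨ ∀ x, conv f (ψ l) x = -conv h (ψ l) x) :
    (∀ l x, conv f (ψ l) x = conv h (ψ l) x) ∨ ∀ l x, conv f (ψ l) x = -conv h (ψ l) x := by
  obtain ⟨U, hU, hcover, hmeet⟩ := hoverlap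
  by_contra! hcon
  obtain ⟨⟨m, y, hm⟩, l, x, hl⟩ := hcon
  -- Two open sets, one for each sign, cover the space and both are nonempty; connectedness makes
  -- them meet, which the overlap condition forbids.
  have hsplit := isPreconnected_univ (α := Rd d)
    (⋃ k ∈ {k | ∀ x, conv f (ψ k) x = conv h (ψ k) x}, U k)
    (⋃ k ∈ {k | ∀ x, conv f (ψ k) x = -conv h (ψ k) x}, U k)
    (isOpen_biUnion fun k _ => (hU k).1) (isOpen_biUnion fun k _ => (hU k).1) ?_ ?_ ?_
  · obtain ⟨ξ, -, hξ, hξ'⟩ := hsplit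
    simp only [Set.mem_iUnion] at hξ hξ'
    obtain ⟨k, hk, hξk⟩ := hξ
    obtain ⟨k', hk', hξk'⟩ := hξ'
    exact not_eq_and_eq_neg_of_overlap hf (hmeet k k' ⟨ξ, hξk, hξk'⟩) hk hk'
  · intro ξ _
    have hξ : ξ ∈ ⋃ k, U k := hcover ▸ Set.mem_univ ξ
    obtain ⟨k, hk⟩ := Set.mem_iUnion.1 hξ
    exact (hfh k).imp (fun h' => Set.mem_biUnion h' hk) fun h' => Set.mem_biUnion h' hk
  · obtain ⟨ξ, hξ⟩ := (hU l).2.1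
    exact ⟨ξ, Set.mem_univ ξ, Set.mem_biUnion ((hfh l).resolve_right fun h' => hl (h' x)) hξ⟩
  · obtain ⟨ξ, hξ⟩ := (hU m).2.1
    exact ⟨ξ, Set.mem_univ ξ, Set.mem_biUnion ((hfh m).resolve_left fun h' => hm (h' y)) hξ⟩

end Signs

end SignRetrieval

/-! ### Sign retrieval -/

theorem theorem4p1 {d : ℕ} {Λ : Type*} (ψ : Λ → SignRetrieval.L2R d)
    (hband : ∀ l, SignRetrieval.IsBandLimited (ψ l))
    (hframe : SignRetrieval.IsSemiDiscreteFrame ψ)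
    (hoverlap : SignRetrieval.HasGoodFSupportOverlap ψ)
    (X : Λ → Set (SignRetrieval.Rd d))
    (hX : ∀ l, SignRetrieval.IsSignBlindSamplingSet (SignRetrieval.freqSupport (ψ l)) (X l))
    (f : SignRetrieval.L2R d)
    (hf : ∃ α : ℝ, 0 < α ∧
      Integrable (fun x : SignRetrieval.Rd d => |f x| * Real.exp (α * ‖x‖)) volume)
    (h : SignRetrieval.L2R d)
    (hsamples : ∀ l, ∀ x ∈ X l,
      |SignRetrieval.conv f (ψ l) x| = |SignRetrieval.conv h (ψ l) x|) :
    h = f ∨ h = -f := by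
  have hsign := fun l => SignRetrieval.conv_eq_or_eq_neg (hX l) (hsamples l)
  have hglobal : (∀ l x, SignRetrieval.conv f (ψ l) x = SignRetrieval.conv h (ψ l) x) ∨
      ∀ l x, SignRetrieval.conv f (ψ l) x = -SignRetrieval.conv h (ψ l) x := by
    -- For `f = 0` the propagation argument is unavailable, but `f ∗ ψ_l = 0` makes the two sign
    -- alternatives coincide.
    rcases eq_or_ne f 0 with rfl | hf0
    · left
      intro l x
      have h0 : SignRetrieval.conv (0 : SignRetrieval.L2R d) (ψ l) x = 0 := by
        have := SignRetrieval.conv_sub_left (SignRetrieval.toComplex (0 : SignRetrieval.L2R d))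
          (SignRetrieval.toComplex 0) (SignRetrieval.toComplex (ψ l)) x
        rw [← SignRetrieval.toComplex_sub, sub_zero, sub_self, SignRetrieval.conv_toComplex] at this
        exact_mod_cast this
      rcases hsign l with h1 | h1
      · exact h1 x
      · have := h1 x
        rw [h0] at this ⊢
        linarith
    · exact SignRetrieval.forall_conv_eq_or_forall_conv_eq_neg hoverlap
        (SignRetrieval.fourierL2_ae_ne_zero hf hf0) hsign
  refine hglobal.imp (fun h1 => ?_) fun h1 => ?_
  · refine (sub_eq_zero.1 (SignRetrieval.toComplex_eq_zero (hframe.eq_zero fun l x => ?_))).symm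
    rw [SignRetrieval.toComplex_sub, SignRetrieval.conv_sub_left, SignRetrieval.conv_toComplex,
      SignRetrieval.conv_toComplex, h1 l x, sub_self]
  · refine eq_neg_of_add_eq_zero_right (SignRetrieval.toComplex_eq_zero
      (hframe.eq_zero fun l x => ?_))
    rw [SignRetrieval.toComplex_add, SignRetrieval.conv_add_left, SignRetrieval.conv_toComplex,
      SignRetrieval.conv_toComplex, h1 l x, Complex.ofReal_neg, neg_add_cancel]
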